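/- Let $X$ be a complex Banach space and $T$ a bounded linear operator on $X$. A bounded operator $S$ on a Banach space $Y$ is \emph{upper semi-Fredholm} if its range $R(S)$ is closed and $\dim\ker S<\infty$; its index is then $\operatorname{ind}(S)=\dim\ker S-\dim (Y/R(S))\in\mathbb Z\cup\{-\infty\}$, and $S$ is \emph{upper semi-Weyl} if moreover $\operatorname{ind}(S)\le 0$. For $n\ge 0$ let $S_n\colon R(S^n)\to R(S^n)$ be the restriction of $S$ (so $S_0=S$). $S$ is \emph{upper semi-B-Fredholm} if for some $n\ge 0$ the range $R(S^n)$ is closed and $S_n$ is upper semi-Fredholm, and \emph{upper semi-B-Weyl} if $n$ can be chosen so that moreover $\operatorname{ind}(S_n)\le 0$ (the value $\operatorname{ind}(S_n)$ does not depend on the choice of such an $n$). Let $\sigma_{uf}(T)$, $\sigma_{uw}(T)$, $\sigma_{ubf}(T)$, $\sigma_{ubw}(T)$ be the sets of $\lambda\in\mathbb C$ for which $T-\lambda I$ is not upper semi-Fredholm, not upper semi-Weyl, not upper semi-B-Fredholm, not upper semi-B-Weyl, respectively, and let $\sigma_a(T)$ be the approximate point spectrum, i.e. the set of $\lambda\in\mathbb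 C$ for which $T-\lambda I$ is not bounded below. Let $p_0(T)$ be the set of poles of $T$, i.e. the isolated points of the spectrum $\sigma(T)$ at which the resolvent $z\mapsto (zI-T)^{-1}$ has a pole, and let $p_{00}(T)=\{\lambda\in p_0(T):\dim\ker(T-\lambda I)<\infty\}$ be the set of poles of finite rank. One says that $T$ satisfies property - $(b)$ if $\sigma_a(T)\setminus\sigma_{uw}(T)=p_{00}(T)$; - $(gb)$ if $\sigma_a(T)\setminus\sigma_{ubw}(T)=p_{0}(T)$; - $(bz_1)$ if $\sigma_a(T)\setminus\sigma_{uf}(T)=p_{00}(T)$; - $(gbz_1)$ if $\sigma_a(T)\setminus\sigma_{ubf}(T)=p_{0}(T)$. Theorem. For every bounded linear operator $T$ on a complex Banach space $X$: (i) $T$ satisfies property $(bz_1)$ if and only if $T$ satisfies property $(b)$ and $\sigma_{uf}(T)=\sigma_{uw}(T)$. (ii) $T$ satisfies property $(gbz_1)$ if and only if $T$ satisfies property $(gb)$ and $\sigma_{ubf}(T)=\sigma_{ubw}(T)$. -/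

import Mathlib

open Topology

namespace SemiBFredholm

section Fredholm

variable {Y : Type*} [NormedAddCommGroup Y] [NormedSpace ℂ Y]

/-- `S` is upper semi-Fredholm: its range is closed and its kernel is finite-dimensional. -/
def IsUpperSemiFredholm (S : Y →L[ℂ] Y) : Prop :=
  IsClosed (Set.range S) ∧ FiniteDimensional ℂ (LinearMap.ker (S : Y →ₗ[ℂ] Y))

open Classical in
/-- The index `dim ker S - codim range S` of an upper semi-Fredholm operator, with values in
`ℤ ∪ {-∞}`; it is `-∞` when the range has infinite codimension. (Only meaningful when the
kernel of `S` is finite-dimensional.) -/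
noncomputable def index (S : Y →L[ℂ] Y) : WithBot ℤ :=
  if FiniteDimensional ℂ (Y ⧸ LinearMap.range (S : Y →ₗ[ℂ] Y)) then
    (((Module.finrank ℂ (LinearMap.ker (S : Y →ₗ[ℂ] Y)) : ℤ) -
      (Module.finrank ℂ (Y ⧸ LinearMap.range (S : Y →ₗ[ℂ] Y)) : ℤ) : ℤ) : WithBot ℤ)
  else ⊥

/-- `S` is upper semi-Weyl: it is upper semi-Fredholm with index `≤ 0`. -/
def IsUpperSemiWeyl (S : Y →L[ℂ] Y) : Prop :=
  IsUpperSemiFredholm S ∧ index S ≤ 0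

/-- The range of `S ^ n`, as a linear subspace. -/
def powRange (S : Y →L[ℂ] Y) (n : ℕ) : Submodule ℂ Y :=
  LinearMap.range ((S ^ n : Y →L[ℂ] Y) : Y →ₗ[ℂ] Y)

theorem mapsTo_powRange (S : Y →L[ℂ] Y) (n : ℕ) :
    ∀ y ∈ powRange S n, S y ∈ powRange S n := by
  rintro _ ⟨x, rfl⟩
  refine ⟨S x, ?_⟩
  change (S ^ n * S) x = (S * S ^ n) x
  rw [← pow_succ, ← pow_succ']

/-- The operator `S_n` induced by `S` on the range of `S ^ n`; in particular `S_0 = S`. -/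
def restrictPow (S : Y →L[ℂ] Y) (n : ℕ) : powRange S n →L[ℂ] powRange S n :=
  S.restrict (mapsTo_powRange S n)

/-- `S` is upper semi-B-Fredholm: for some `n`, the range of `S ^ n` is closed and `S_n` is
upper semi-Fredholm. -/
def IsUpperSemiBFredholm (S : Y →L[ℂ] Y) : Prop :=
  ∃ n : ℕ, IsClosed (powRange S n : Set Y) ∧ IsUpperSemiFredholm (restrictPow S n)

/-- `S` is upper semi-B-Weyl: it is upper semi-B-Fredholm with index `≤ 0`, where the index of
`S` is the index of `S_n` (for any `n` as in the definition of upper semi-B-Fredholm). -/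
def IsUpperSemiBWeyl (S : Y →L[ℂ] Y) : Prop :=
  ∃ n : ℕ, IsClosed (powRange S n : Set Y) ∧ IsUpperSemiFredholm (restrictPow S n) ∧
    index (restrictPow S n) ≤ 0

/-- `S` is bounded below. -/
def IsBoundedBelow (S : Y →L[ℂ] Y) : Prop :=
  ∃ c : ℝ, 0 < c ∧ ∀ y : Y, c * ‖y‖ ≤ ‖S y‖

end Fredholm

section Spectra

variable {X : Type*} [NormedAddCommGroup X] [NormedSpace ℂ X]

/-- The operator `T - l I`. -/
noncomputable def shift (T : X →L[ℂ] X) (l : ℂ) : X →L[ℂ] X :=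
  T - l • ContinuousLinearMap.id ℂ X

/-- The approximate point spectrum `σ_a(T)`. -/
def sigmaA (T : X →L[ℂ] X) : Set ℂ := {l | ¬ IsBoundedBelow (shift T l)}

/-- The upper semi-Fredholm spectrum `σ_uf(T)`. -/
def sigmaUF (T : X →L[ℂ] X) : Set ℂ := {l | ¬ IsUpperSemiFredholm (shift T l)}

/-- The upper semi-Weyl spectrum `σ_uw(T)`. -/
def sigmaUW (T : X →L[ℂ] X) : Set ℂ := {l | ¬ IsUpperSemiWeyl (shift T l)}

/-- The upper semi-B-Fredholm spectrum `σ_ubf(T)`. -/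
def sigmaUBF (T : X →L[ℂ] X) : Set ℂ := {l | ¬ IsUpperSemiBFredholm (shift T l)}

/-- The upper semi-B-Weyl spectrum `σ_ubw(T)`. -/
def sigmaUBW (T : X →L[ℂ] X) : Set ℂ := {l | ¬ IsUpperSemiBWeyl (shift T l)}

/-- The poles of `T`: isolated points `l` of the spectrum at which the resolvent
`z ↦ (z I - T)⁻¹` has a pole (of some finite order `≥ 1`). -/
def poles (T : X →L[ℂ] X) : Set ℂ :=
  {l | l ∈ spectrum ℂ T ∧ (∀ᶠ z in 𝓝[≠] l, z ∉ spectrum ℂ T) ∧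
    MeromorphicAt (resolvent T) l ∧ meromorphicOrderAt (resolvent T) l < 0}

/-- The poles of `T` of finite rank: the poles `l` such that `ker (T - l I)` is
finite-dimensional. -/
def polesFiniteRank (T : X →L[ℂ] X) : Set ℂ :=
  {l | l ∈ poles T ∧ FiniteDimensional ℂ (LinearMap.ker (shift T l : X →ₗ[ℂ] X))}

/-- Property (b): `σ_a(T) \ σ_uw(T)` is the set of poles of finite rank. -/
def PropertyB (T : X →L[ℂ] X) : Prop := sigmaA T \ sigmaUW T = polesFiniteRank T

/-- Property (gb): `σ_a(T) \ σ_ubw(T)` is the set of poles. -/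
def PropertyGB (T : X →L[ℂ] X) : Prop := sigmaA T \ sigmaUBW T = poles T

/-- Property (bz₁): `σ_a(T) \ σ_uf(T)` is the set of poles of finite rank. -/
def PropertyBZ1 (T : X →L[ℂ] X) : Prop := sigmaA T \ sigmaUF T = polesFiniteRank T

/-- Property (gbz₁): `σ_a(T) \ σ_ubf(T)` is the set of poles. -/
def PropertyGBZ1 (T : X →L[ℂ] X) : Prop := sigmaA T \ sigmaUBF T = poles T

end Spectra

end SemiBFredholm

namespace SemiBFredholm

section Ascent

variable {E : Type*} [AddCommGroup E] [Module ℂ E]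

/-! Once the Fredholm and Weyl spectra agree, the two properties are the same equation, so it
remains to see that (bz₁), resp. (gbz₁), forces this agreement. Suppose `T - l I` is (B-)Fredholm.
If it is bounded below, it is injective with closed range, hence (B-)Weyl. Otherwise the property
makes `l` a pole; there `T - l I` has finite ascent (`exists_ker_pow_le_of_mem_poles`), and finite
ascent forces index `≤ 0` (`finrank_ker_le_finrank_quotient_range`). -/

theorem finiteDimensional_ker_pow (f : E →ₗ[ℂ] E) [FiniteDimensional ℂ (LinearMap.ker f)]
    (n : ℕ) : FiniteDimensional ℂ (LinearMap.ker (f ^ n)) := by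
  induction n with
  | zero =>
    have h : LinearMap.ker (f ^ 0) = ⊥ := by
      rw [pow_zero]
      exact LinearMap.ker_id
    rw [h]
    infer_instance
  | succ n ih =>
    -- `f` maps `ker f^(n+1)` into `ker f^n`, with kernel inside `ker f`.
    let g : LinearMap.ker (f ^ (n + 1)) →ₗ[ℂ] LinearMap.ker (f ^ n) :=
      f.restrict fun x hx => by
        rw [LinearMap.mem_ker, pow_succ] at hx
        exact hx
    let i : LinearMap.ker g →ₗ[ℂ] LinearMap.ker f :=
      LinearMap.codRestrict _ ((LinearMap.ker (f ^ (n + 1))).subtype ∘ₗ (LinearMap.ker g).subtype)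
        fun x => congrArg Subtype.val x.2
    have hi : Function.Injective i := fun x y h =>
      Subtype.ext (Subtype.ext
      (congrArg (fun z : LinearMap.ker f => (z : E)) h))
    have : FiniteDimensional ℂ (LinearMap.ker g) := FiniteDimensional.of_injective i hi
    have : FiniteDimensional ℂ (LinearMap.ker (f ^ (n + 1)) ⧸ LinearMap.ker g) :=
      Module.Finite.equiv g.quotKerEquivRange.symm
    exact Module.Finite.of_submodule_quotient (LinearMap.ker g)

/-- A linear map of finite ascent with finite-dimensional kernel and cokernel has nonpositive
index. -/
theorem finrank_ker_le_finrank_quotient_range (f : E →ₗ[ℂ] E)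
    [FiniteDimensional ℂ (LinearMap.ker f)] [FiniteDimensional ℂ (E ⧸ LinearMap.range f)]
    {n : ℕ} (hn : LinearMap.ker (f ^ (n + 1)) ≤ LinearMap.ker (f ^ n)) :
    Module.finrank ℂ (LinearMap.ker f) ≤ Module.finrank ℂ (E ⧸ LinearMap.range f) := by
  have hK := finiteDimensional_ker_pow f (n + 1)
  let K := LinearMap.ker (f ^ (n + 1))
  have hmaps : ∀ x ∈ K, f x ∈ K := fun x hx => by
    have hx' : (f ^ (n + 1)) x = 0 := hx
    change (f ^ (n + 1) * f) x = 0
    rw [← pow_succ, pow_succ']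
    exact (congrArg f hx').trans (map_zero f)
  let g : K →ₗ[ℂ] K := f.restrict hmaps
  have hker : LinearMap.ker f ≤ K := fun x hx => by
    change (f ^ (n + 1)) x = 0
    rw [pow_succ]
    exact (congrArg (f ^ n) hx).trans (map_zero _)
  let i : LinearMap.ker f →ₗ[ℂ] LinearMap.ker g :=
    LinearMap.codRestrict _ (Submodule.inclusion hker) fun x => Subtype.ext x.2
  have hi : Function.Injective i := fun x y h =>
    Subtype.ext (congrArg (fun z : LinearMap.ker g => ((z : K) : E)) h)
  have h₁ := LinearMap.finrank_le_finrank_of_injective hi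
  let q : K →ₗ[ℂ] E ⧸ LinearMap.range f := (LinearMap.range f).mkQ ∘ₗ K.subtype
  -- If `f x ∈ K`, finite ascent puts `f x` in `ker f^n`, so `x ∈ K`: thus `range f ∩ K ⊆ f(K)`.
  have hq : LinearMap.ker q ≤ LinearMap.range g := by
    rintro ⟨y, hy⟩ h
    obtain ⟨x, rfl⟩ := (Submodule.Quotient.mk_eq_zero _).1 h
    have hx : x ∈ LinearMap.ker (f ^ (n + 1)) := by
      have h2 : f x ∈ LinearMap.ker (f ^ n) := hn hy
      rw [LinearMap.mem_ker, pow_succ]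
      exact h2
    exact ⟨⟨x, hx⟩, rfl⟩
  have h₂ := Submodule.finrank_mono hq
  have h₃ := g.finrank_range_add_finrank_ker
  have h₄ := q.finrank_range_add_finrank_ker
  have h₅ := Submodule.finrank_le (LinearMap.range q)
  -- `dim ker f ≤ dim ker g = dim K - rank g ≤ dim K - dim ker q = rank q ≤ codim range f`.
  omega

end Ascent

section Index

variable {Y : Type*} [NormedAddCommGroup Y] [NormedSpace ℂ Y]

theorem index_nonpos_of_ker_pow_le {S : Y →L[ℂ] Y}
    (hS : FiniteDimensional ℂ (LinearMap.ker (S : Y →ₗ[ℂ] Y))) {n : ℕ}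
    (hn : ∀ y, (S ^ (n + 1)) y = 0 → (S ^ n) y = 0) : index S ≤ 0 := by
  unfold index
  split_ifs with h
  · have hle := finrank_ker_le_finrank_quotient_range (S : Y →ₗ[ℂ] Y) (n := n) fun y hy => by
      rw [LinearMap.mem_ker, ← ContinuousLinearMap.toLinearMap_pow] at hy ⊢
      exact hn y hy
    rw [← WithBot.coe_zero, WithBot.coe_le_coe]
    omega
  · exact bot_le

theorem coe_restrictPow_pow_apply (S : Y →L[ℂ] Y) (m n : ℕ) (y : powRange S m) :
    (((restrictPow S m ^ n) y : powRange S m) : Y) = (S ^ n) y := by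
  induction n with
  | zero => rfl
  | succ n ih =>
    rw [pow_succ', pow_succ']
    exact congrArg S ih

theorem IsBoundedBelow.isUpperSemiWeyl [CompleteSpace Y] {S : Y →L[ℂ] Y}
    (hS : IsBoundedBelow S) : IsUpperSemiWeyl S := by
  obtain ⟨c, hc, h⟩ := hS
  have hanti : AntilipschitzWith (Real.toNNReal c⁻¹) S :=
    S.antilipschitz_of_bound fun y => by
      rw [Real.coe_toNNReal _ (inv_nonneg.2 hc.le), inv_mul_eq_div, le_div_iff₀ hc, mul_comm]
      exact h y
  have hker : LinearMap.ker (S : Y →ₗ[ℂ] Y) = ⊥ := LinearMap.ker_eq_bot.2 hanti.injective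
  have hfin : FiniteDimensional ℂ (LinearMap.ker (S : Y →ₗ[ℂ] Y)) := by
    rw [hker]
    infer_instance
  refine ⟨⟨hanti.isClosed_range S.uniformContinuous, hfin⟩,
    index_nonpos_of_ker_pow_le hfin (n := 0) fun y hy => ?_⟩
  rw [zero_add, pow_one] at hy
  exact hanti.injective (hy.trans (map_zero S).symm)

theorem IsBoundedBelow.isUpperSemiBWeyl [CompleteSpace Y] {S : Y →L[ℂ] Y}
    (hS : IsBoundedBelow S) : IsUpperSemiBWeyl S := by
  have hclosed : IsClosed (powRange S 0 : Set Y) := by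
    have h : (powRange S 0 : Set Y) = Set.univ :=
      Set.eq_univ_of_forall fun y => ⟨y, rfl⟩
    rw [h]
    exact isClosed_univ
  have : CompleteSpace (powRange S 0) := hclosed.completeSpace_coe
  have hb : IsBoundedBelow (restrictPow S 0) := by
    obtain ⟨c, hc, h⟩ := hS
    exact ⟨c, hc, fun y => h y⟩
  exact ⟨0, hclosed, hb.isUpperSemiWeyl⟩

theorem IsUpperSemiFredholm.isUpperSemiWeyl {S : Y →L[ℂ] Y} (hS : IsUpperSemiFredholm S) {n : ℕ}
    (hn : ∀ y, (S ^ (n + 1)) y = 0 → (S ^ n) y = 0) : IsUpperSemiWeyl S :=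
  ⟨hS, index_nonpos_of_ker_pow_le hS.2 hn⟩

/-- Powers of `S_m` are restrictions of powers of `S`, so a bound on the ascent of `S` also bounds
that of `S_m`. -/
theorem IsUpperSemiBFredholm.isUpperSemiBWeyl {S : Y →L[ℂ] Y} (hS : IsUpperSemiBFredholm S)
    {n : ℕ} (hn : ∀ y, (S ^ (n + 1)) y = 0 → (S ^ n) y = 0) : IsUpperSemiBWeyl S := by
  obtain ⟨m, hm, hF⟩ := hS
  refine ⟨m, hm, hF.isUpperSemiWeyl (n := n) fun y hy => Subtype.ext ?_⟩
  have h := congrArg Subtype.val hy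
  rw [coe_restrictPow_pow_apply] at h ⊢
  exact hn _ h

end Index

section Spectra

variable {X : Type*} [NormedAddCommGroup X] [NormedSpace ℂ X]

/-- At a pole `l` of the resolvent, `T - l I` has finite ascent. -/
theorem exists_ker_pow_le_of_mem_poles {T : X →L[ℂ] X} {l : ℂ} (hl : l ∈ poles T) :
    ∃ n : ℕ, ∀ x, (shift T l ^ (n + 1)) x = 0 → (shift T l ^ n) x = 0 := by
  -- `n` is chosen so that `(z - l)^n R(z)` is analytic at `l`, with `R` the resolvent; one more
  -- factor `z - l` makes it tend to `0`.
  obtain ⟨-, hiso, ⟨n, hn⟩, -⟩ := hl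
  refine ⟨n, fun x hx => ?_⟩
  set S := shift T l with hS
  -- The geometric sum satisfies `G z = R(z) ((z - l)^(n+1) - S^(n+1))` near `l` and `G l = S^n`.
  -- When `S^(n+1) x = 0`, comparing limits of `G z x = (z - l)^(n+1) R(z) x` gives `S^n x = 0`.
  let G : ℂ → X →L[ℂ] X := fun z =>
    ∑ i ∈ Finset.range (n + 1), (algebraMap ℂ (X →L[ℂ] X) (z - l)) ^ i * S ^ (n - i)
  have hG : Filter.Tendsto (fun z => G z x) (𝓝[≠] l) (𝓝 ((S ^ n) x)) := by
    have hGl : G l = S ^ n := by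
      simp only [G, sub_self, map_zero]
      rw [Finset.sum_eq_single 0 (fun i _ hi => by rw [zero_pow hi, zero_mul]) (by simp)]
      simp
    have hc : Continuous G := by
      have ha : Continuous fun z : ℂ => algebraMap ℂ (X →L[ℂ] X) (z - l) := by
        simp only [Algebra.algebraMap_eq_smul_one]
        fun_prop
      exact continuous_finsetSum _ fun i _ => (ha.pow i).mul continuous_const
    have := (hc.clm_apply (continuous_const (y := x))).tendsto l
    rw [hGl] at this
    exact this.mono_left nhdsWithin_le_nhds
  have hF : Filter.Tendsto (fun z => (z - l) • ((z - l) ^ n • resolvent T z) x) (𝓝[≠] l)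
      (𝓝 0) := by
    have h : ContinuousAt (fun z => (z - l) • ((z - l) ^ n • resolvent T z) x) l :=
      (continuousAt_id.sub continuousAt_const).smul
        (hn.continuousAt.clm_apply continuousAt_const)
    have := h.tendsto
    simp only [sub_self, zero_smul] at this
    exact this.mono_left nhdsWithin_le_nhds
  refine tendsto_nhds_unique (hG.congr' ?_) hF
  filter_upwards [hiso] with z hz
  have hu : IsUnit (algebraMap ℂ (X →L[ℂ] X) z - T) := spectrum.notMem_iff.1 hz
  have hshift : algebraMap ℂ (X →L[ℂ] X) z - T = algebraMap ℂ (X →L[ℂ] X) (z - l) - S := by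
    rw [hS, shift, map_sub, Algebra.algebraMap_eq_smul_one l]
    change _ = _ - l • (1 : X →L[ℂ] X) - (T - l • (1 : X →L[ℂ] X))
    abel
  have hgeom := (Algebra.commute_algebraMap_left (z - l) S).mul_geom_sum₂ (n + 1)
  have hinv : resolvent T z * (algebraMap ℂ (X →L[ℂ] X) z - T) = 1 :=
    Ring.inverse_mul_cancel _ hu
  have hGz : G z = resolvent T z * (algebraMap ℂ (X →L[ℂ] X) (z - l) ^ (n + 1) - S ^ (n + 1)) := by
    rw [← hgeom, ← hshift, ← mul_assoc, hinv, one_mul]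
    rfl
  have hpow : (algebraMap ℂ (X →L[ℂ] X) (z - l) ^ (n + 1)) x = (z - l) ^ (n + 1) • x := by
    rw [← map_pow, Algebra.algebraMap_eq_smul_one]
    rfl
  have happ : G z x = resolvent T z ((z - l) ^ (n + 1) • x) := by
    rw [hGz, mul_apply_eq_comp, sub_apply, hx, hpow, sub_zero]
  rw [happ, map_smul, smul_apply, smul_smul, pow_succ']

theorem sigmaUF_subset_sigmaUW (T : X →L[ℂ] X) : sigmaUF T ⊆ sigmaUW T :=
  fun _ h hW => h hW.1

theorem sigmaUBF_subset_sigmaUBW (T : X →L[ℂ] X) : sigmaUBF T ⊆ sigmaUBW T :=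
  fun _ h ⟨n, h₁, h₂, _⟩ => h ⟨n, h₁, h₂⟩

theorem PropertyBZ1.sigmaUF_eq_sigmaUW [CompleteSpace X] {T : X →L[ℂ] X} (h : PropertyBZ1 T) :
    sigmaUF T = sigmaUW T := by
  refine (sigmaUF_subset_sigmaUW T).antisymm fun l hl => ?_
  by_contra hF
  by_cases ha : l ∈ sigmaA T
  · have hp : l ∈ polesFiniteRank T := h ▸ ⟨ha, hF⟩
    obtain ⟨n, hn⟩ := exists_ker_pow_le_of_mem_poles hp.1
    exact hl ((not_not.1 hF).isUpperSemiWeyl hn)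
  · exact hl (not_not.1 ha).isUpperSemiWeyl

theorem PropertyGBZ1.sigmaUBF_eq_sigmaUBW [CompleteSpace X] {T : X →L[ℂ] X}
    (h : PropertyGBZ1 T) : sigmaUBF T = sigmaUBW T := by
  refine (sigmaUBF_subset_sigmaUBW T).antisymm fun l hl => ?_
  by_contra hF
  by_cases ha : l ∈ sigmaA T
  · have hp : l ∈ poles T := h ▸ ⟨ha, hF⟩
    obtain ⟨n, hn⟩ := exists_ker_pow_le_of_mem_poles hp
    exact hl ((not_not.1 hF).isUpperSemiBWeyl hn)
  · exact hl (not_not.1 ha).isUpperSemiBWeyl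

end Spectra

end SemiBFredholm

theorem mainTheorem3 {X : Type*} [NormedAddCommGroup X] [NormedSpace ℂ X] [CompleteSpace X]
    (T : X →L[ℂ] X) :
    (SemiBFredholm.PropertyBZ1 T ↔
      SemiBFredholm.PropertyB T ∧ SemiBFredholm.sigmaUF T = SemiBFredholm.sigmaUW T) ∧
    (SemiBFredholm.PropertyGBZ1 T ↔
      SemiBFredholm.PropertyGB T ∧ SemiBFredholm.sigmaUBF T = SemiBFredholm.sigmaUBW T) := by
  refine ⟨⟨fun h => ?_, fun ⟨h, he⟩ => ?_⟩, ⟨fun h => ?_, fun ⟨h, he⟩ => ?_⟩⟩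
  · have he := h.sigmaUF_eq_sigmaUW
    refine ⟨?_, he⟩
    rw [SemiBFredholm.PropertyB, ← he]
    exact h
  · rw [SemiBFredholm.PropertyBZ1, he]
    exact h
  · have he := h.sigmaUBF_eq_sigmaUBW
    refine ⟨?_, he⟩
    rw [SemiBFredholm.PropertyGB, ← he]
    exact h
  · rw [SemiBFredholm.PropertyGBZ1, he]
    exact h
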